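/- **Setting.** Requests $1,\dots,n$ are located at nodes of a metric graph (a metric space $X$ of nodes); request $i$ has a time window $[w_i,d_i)$ with $1\le d_i-w_i\le 2$. A service run of speed $v$ services some of the requests, each at one time, such that the distance between the nodes of any two serviced requests is at most $v$ times the difference of their service times; it may start anywhere at any time. Its profit is the number of requests serviced during their windows. The set of periods of length $\alpha$ with starting point $\theta$ consists of the intervals $[\theta+p\alpha,\theta+(p+1)\alpha)$, $p\in\mathbb Z$; a window is in $W_\ell$ for this set of periods if it completely contains exactly $\ell$ of them, where periods that begin at the very start of the window are not counted (no window is regarded as starting at the beginning of a period). **The parameters $\gamma$ and $\Gamma$.** Let $\mathcal A$ be an algorithm for *trimmed* windows (every request has one period of one common set of periods as its window, or no window) which, at every speed $v>0$, finds a run of speed $v$ whose profit on the trimmed windows is at least $1/\gamma$ times the profit of every run of speed $v$, in at most $\Gamma(n)$ steps on $n$ requests, where $\Gamma(n)\ge n$. **The algorithm.** SPEEDUP, for $\alpha$, a starting point $\theta_0$ and a rule that says which of its full periods a window in $W_\ell$ is trimmed to, does the following for a number of sets of periods of length $\alpha$: trim the windows, run $\mathcal A$ at speed $s$, and retain the best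 run found. If the speedup is given as a fraction $s=q/r$, written (after doubling $q$ and $r$ if necessary) so that $q+r$ is even, the starting points are $\theta_0+c\alpha/r$, $0\le c<r$, unless there are at most $r$ distinct sets of periods, in which case one of each kind is tried; for a real number $s$ not given as a fraction, one of each kind is tried. Here two sets of periods of length $\alpha$ are not distinct if one can be moved into the other without a division passing a window endpoint $w_i$ or $d_i$, so their number is the number of different residues of the $w_i$ and $d_i$ modulo $\alpha$. SPEEDUPW12 runs SPEEDUP and returns the best run found: (1) for $\alpha=1/2$, $\theta_0\in\{0,\frac14\}$, trimming windows in $W_1,W_2,W_3$ to their first, $j$-th, $k$-th full period, for all $j\in\{1,2\}$, $k\in\{1,2,3\}$; (2) for $\alpha=3/4$, $\theta_0\in\{0,\frac14,\frac24\}$, trimming windows in $W_1,W_2$ to their first, $j$-th full period, for $j\in\{1,2\}$, and dropping all others; (3) for $\alpha=1$, $\theta_0\in\{0,\frac14,\frac24,\frac34\}$, trimming windows in $W_1$ to their full period, and dropping all others. **Theorem.** There is an absolute constant $C$ such that, for all such $X,\mathcal A,\gamma,\Gamma$ and all such inputs, and for every speedup $s$ with $7/3\le s\le 17/7$, SPEEDUPW12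 finds a run $\hat R$ of speed $s$ that is an $8\gamma/(s^2-4s+7)$-approximation on windows in $W_3$: for every set of periods of length $1/2$ and every run $R^*$ of speed $1$, the number of requests with windows in $W_3$ that $R^*$ services during their windows is at most $$\frac{8\gamma}{s^2-4s+7}\cdot\mathrm{profit}(\hat R).$$ In particular, if all windows of the input are in $W_3$, then $\mathrm{profit}(R^*)\le\frac{8\gamma}{s^2-4s+7}\,\mathrm{profit}(\hat R)$. Moreover, for $n\ge 1$, SPEEDUPW12 takes at most $C\,\min\{r,m\}\,\Gamma(n)$ steps, where $m$ is the number of distinct sets of periods of length $1/2$, and where $\min\{r,m\}$ is to be read as $m$ if $s$ is not given as a fraction $q/r$. -/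

import Mathlib

noncomputable section

namespace Repairman

universe u

/-! ### Step-counted computation

`Timed β` is the result of a computation together with the number of elementary steps used to obtain
it.  The programs below are written for a real-number machine: an arithmetic operation, a floor, a
comparison, an assignment, or a read or write of a cell of an array or a list is one step, and the
number of steps is charged where it is performed (`cost k`). -/

structure Timed (β : Type) where
  val : β
  steps : ℕ

instance : Monad Timed where
  pure a := ⟨a, 0⟩
  bind x f := ⟨(f x.val).val, x.steps + (f x.val).steps⟩

/-- The value `a`, obtained by `k` elementary operations. -/
def cost {β : Type} (k : ℕ) (a : β) : Timed β := ⟨a, k⟩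

/-- The loop "for `b` in the list, in order: `s := body s b`", started with the state `s`;
one step of loop control for each round and one for leaving the loop. -/
def forEach {σ β : Type} : List β → σ → (σ → β → Timed σ) → Timed σ
  | [], s, _ => cost 1 s
  | b :: l, s, body => do
      let s' ← body s b
      let s'' ← cost 1 s'
      forEach l s'' body

/-- The array whose `i`-th cell is filled with the result of `body i`, for `i = 0, …, n - 1`;
one step of loop control and writing for each cell. -/
def buildArray {n : ℕ} {β : Type} (body : Fin n → Timed β) : Timed (Fin n → β) :=
  ⟨fun i => (body i).val, ∑ i, ((body i).steps + 1)⟩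

/-! ### The repairman problem -/

/-- The time window `[release, deadline)` of a service request. -/
structure Window where
  release : ℝ
  deadline : ℝ

/-- A service run for the requests `0, …, n - 1`: `R i = some t` means that the repairman services
request `i` at time `t`, and `R i = none` that he does not service it. -/
abbrev Run (n : ℕ) := Fin n → Option ℝ

/-- The repairman can perform the run when he travels at speed (at most) `v` in the metric graph with
request `i` located at the node `loc i`: between any two services there is enough time to travel the
distance between their nodes (by the triangle inequality it is the same to ask this for consecutive
services only).  The run is unrooted: the first service may be anywhere and at any time. -/
def Feasible {X : Type u} [MetricSpace X] {n : ℕ} (loc : Fin n → X) (v : ℝ) (R : Run n) : Prop :=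
  ∀ i j : Fin n, ∀ t u : ℝ, R i = some t → R j = some u → dist (loc i) (loc j) ≤ v * |t - u|

/-- The requests that the run services during their time windows. -/
def served {n : ℕ} (win : Fin n → Window) (R : Run n) : Set (Fin n) :=
  {i | ∃ t, R i = some t ∧ (win i).release ≤ t ∧ t < (win i).deadline}

/-- The profit of a run: the number of requests serviced during their time windows. -/
def profit {n : ℕ} (win : Fin n → Window) (R : Run n) : ℕ := (served win R).ncard

/-- The part of the profit of a run that comes from the requests in `S`. -/
def profitOn {n : ℕ} (S : Set (Fin n)) (win : Fin n → Window) (R : Run n) : ℕ :=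
  (served win R ∩ S).ncard

/-! ### Periods and trimming

The set of periods of length `α` with starting point `θ` consists of the periods
`[θ + p * α, θ + (p + 1) * α)`, `p ∈ ℤ`. -/

/-- The periods that are completely contained in a window.  No window is to start at the beginning
of a period; the strict inequality achieves this (in effect, the divisions lie infinitesimally
earlier than written), so that the window always overlaps partially with the period just before. -/
def fullPeriods (α θ : ℝ) (w : Window) : Set ℤ :=
  {p | w.release < θ + p * α ∧ θ + (p + 1) * α ≤ w.deadline}

/-- The window is in the set `W_ℓ` for the set of periods of length `α` with starting point `θ`:
it completely fills exactly `ℓ` periods (and overlaps partially with the one before and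
the one after them). -/
def InW (ℓ : ℕ) (α θ : ℝ) (w : Window) : Prop := (fullPeriods α θ w).ncard = ℓ

/-- The number of the first period that starts after the release time. -/
def firstPeriod (α θ : ℝ) (w : Window) : ℤ := ⌊(w.release - θ) / α⌋ + 1

/-- The number of the period that contains the deadline. -/
def lastPeriod (α θ : ℝ) (w : Window) : ℤ := ⌊(w.deadline - θ) / α⌋

theorem fullPeriods_eq {α : ℝ} (hα : 0 < α) (θ : ℝ) (w : Window) :
    fullPeriods α θ w = Set.Ico (firstPeriod α θ w) (lastPeriod α θ w) := by
  ext p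
  have h1 : w.release < θ + p * α ↔ firstPeriod α θ w ≤ p := by
    rw [firstPeriod, Int.add_one_le_iff, Int.floor_lt, div_lt_iff₀ hα]
    constructor <;> intro h <;> linarith
  have h2 : θ + (p + 1) * α ≤ w.deadline ↔ p < lastPeriod α θ w := by
    rw [lastPeriod, ← Int.add_one_le_iff, Int.le_floor, le_div_iff₀ hα]
    push_cast
    constructor <;> intro h <;> linarith
  simp only [fullPeriods, Set.mem_ofPred_eq, Set.mem_Ico, h1, h2]

/-- A trimming scheme says, for each `ℓ`, to which of its `ℓ` full periods (counted from 1) a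
window in `W_ℓ` is trimmed; `none` means that the window vanishes. -/
abbrev Scheme := ℤ → Option ℤ

/-- Trim a window: the number of the one period that is kept, if any. -/
def trim (α θ : ℝ) (scheme : Scheme) (w : Window) : Timed (Option ℤ) := do
  let p ← cost 4 (firstPeriod α θ w)
  let p' ← cost 3 (lastPeriod α θ w)
  let ℓ ← cost 1 (p' - p)
  let c ← cost 3 (scheme ℓ)
  match c with
  | none => cost 1 none
  | some k => cost 2 (some (p + k - 1))

/-- The outcome of trimming: request `i` has the period number `idx i` of the set of periods of
length `len` with starting point `start` as its window, or no window.  So the trimmed windows are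
pairwise either identical or disjoint. -/
structure Trimmed (n : ℕ) where
  len : ℝ
  start : ℝ
  idx : Fin n → Option ℤ

/-- The number of requests that the run services during their trimmed windows. -/
def Trimmed.profit {n : ℕ} (T : Trimmed n) (R : Run n) : ℕ :=
  {i : Fin n | ∃ t p, R i = some t ∧ T.idx i = some p ∧
    T.start + p * T.len ≤ t ∧ t < T.start + (p + 1) * T.len}.ncard

/-! ### The parameters `γ` and `Γ`

A repairman algorithm for trimmed windows is given the locations of the requests, a speed and
trimmed windows, and computes a run.  The quality `γ` and the running time `Γ` depend on the class
of graphs at hand (trees, metric graphs, ...). -/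

/-- A step-counted algorithm for the repairman problem on trimmed windows. -/
abbrev TrimmedSolver (X : Type u) :=
  ∀ n : ℕ, (Fin n → X) → ℝ → Trimmed n → Timed (Run n)

/-- At every speed `v`, the algorithm computes a run of speed `v` whose profit on the trimmed windows
is within the factor `γ` of that of every other run of speed `v`. -/
def TrimmedSolver.HasRatio {X : Type u} [MetricSpace X] (A : TrimmedSolver X) (γ : ℝ) : Prop :=
  ∀ (n : ℕ) (loc : Fin n → X) (v : ℝ) (T : Trimmed n), 0 < v → 0 < T.len →
    Feasible loc v (A n loc v T).val ∧
    ∀ R : Run n, Feasible loc v R → (T.profit R : ℝ) ≤ γ * T.profit (A n loc v T).val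

/-- The algorithm takes at most `Γ n` steps on `n` requests. -/
def TrimmedSolver.RunsIn {X : Type u} (A : TrimmedSolver X) (Γ : ℕ → ℝ) : Prop :=
  ∀ (n : ℕ) (loc : Fin n → X) (v : ℝ) (T : Trimmed n), 0 < v → 0 < T.len →
    ((A n loc v T).steps : ℝ) ≤ Γ n

/-! ### Speedup -/

/-- A speedup, either given as a fraction `q / r` or as an arbitrary real number. -/
inductive Speedup where
  | ratio (q r : ℕ)
  | real (s : ℝ)

/-- The value `s` of the speedup. -/
def Speedup.val : Speedup → ℝ
  | .ratio q r => (q : ℝ) / r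
  | .real s => s

/-- The number of shifted sets of periods that are used for a speedup `q / r`: it is `r` when the
fraction is written so that `q + r` is even, which may require to double `q` and `r`. -/
def Speedup.shifts : Speedup → ℕ∞
  | .ratio q r => if Even (q + r) then (r : ℕ∞) else ((2 * r : ℕ) : ℕ∞)
  | .real _ => ⊤

/-- `min {r, m}`, which is to be read as `m` for a speedup that is not given as a fraction `q / r`. -/
def Speedup.minDen : Speedup → ℕ → ℕ
  | .ratio _ r, m => min r m
  | .real _, m => m

/-- The position of the time `x` relative to the periods of length `α` with starting point `0`. -/
def residue (α x : ℝ) : ℝ := x - α * ⌊x / α⌋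

/-- The number of distinct sets of periods of length `α`: as the starting point moves, the periods that
are contained in the windows change only when a division passes a release time or a deadline, and so
it is the number of different positions that these have relative to periods of length `α`. -/
def numPeriodSets {n : ℕ} (α : ℝ) (win : Fin n → Window) : ℕ :=
  (Set.range (fun i => residue α (win i).release) ∪
    Set.range (fun i => residue α (win i).deadline)).ncard

/-! ### The algorithm SPEEDUP -/

/-- Linear search. -/
def search (x : ℝ) : List ℝ → Timed Bool
  | [] => cost 1 false
  | y :: l => do
      let b ← cost 2 (decide (x = y))
      if b then cost 1 true else search x l

/-- Insert the position of `x` into a list of distinct positions that comes with its length, unless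
it is there already; give up (`none`) when the list would get longer than `cap`. -/
def insertResidue (α : ℝ) (cap : ℕ∞) :
    Option (List ℝ × ℕ) → ℝ → Timed (Option (List ℝ × ℕ))
  | none, _ => cost 1 none
  | some (l, c), x => do
      let y ← cost 4 (residue α x)
      let b ← search y l
      if b then cost 1 (some (l, c)) else do
        let full ← cost 1 (decide (cap ≤ (c : ℕ∞)))
        if full then cost 1 none else cost 2 (some (y :: l, c + 1))

/-- All the different positions of release times and deadlines, or `none` if there are more than
`cap`. -/
def distinctResidues {n : ℕ} (α : ℝ) (cap : ℕ∞) (win : Fin n → Window) :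
    Timed (Option (List ℝ × ℕ)) :=
  forEach (List.finRange n) (some ([], 0)) fun st i => do
    let st' ← insertResidue α cap st (win i).release
    insertResidue α cap st' (win i).deadline

/-- The starting points `θ₀ + c * α / r`, `0 ≤ c < r`: each set of periods is shifted by one `r`-th of
a period against the preceding one. -/
def gridPoints (α θ₀ : ℝ) (r : ℕ) : Timed (List ℝ) :=
  forEach (List.range r) [] fun l c => cost 4 ((θ₀ + c * α / r) :: l)

/-- The starting points of the sets of periods that are tried: one for each of the distinct sets of
periods, unless these are more than the shifted sets of periods that the speedup `q / r` asks for. -/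
def startingPoints {n : ℕ} (s : Speedup) (α θ₀ : ℝ) (win : Fin n → Window) : Timed (List ℝ) := do
  let cap ← cost 4 s.shifts
  let found ← distinctResidues α cap win
  match found with
  | some (l, _) => cost 1 l
  | none => gridPoints α θ₀ cap.toNat

/-- Count the requests that the run services during their windows. -/
def countServed {n : ℕ} (win : Fin n → Window) (R : Run n) : Timed ℕ :=
  forEach (List.finRange n) 0 fun c i =>
    match R i with
    | none => cost 1 c
    | some t => do
        let b ← cost 3 (decide ((win i).release ≤ t) && decide (t < (win i).deadline))
        if b then cost 1 (c + 1) else cost 1 c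

/-- SPEEDUP for periods of length `α`, the starting point `θ₀` and a trimming scheme: for each of the
sets of periods, trim the windows, run the algorithm `A` for trimmed windows at the increased speed,
and retain the best run so far (kept in `best`, together with its profit). -/
def speedup {X : Type u} (A : TrimmedSolver X) {n : ℕ} (loc : Fin n → X) (win : Fin n → Window)
    (s : Speedup) (α θ₀ : ℝ) (scheme : Scheme) (best : Run n × ℕ) : Timed (Run n × ℕ) := do
  let starts ← startingPoints s α θ₀ win
  forEach starts best fun best θ => do
    let idx ← buildArray fun i => trim α θ scheme (win i)
    let R ← A n loc s.val ⟨α, θ, idx⟩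
    let c ← countServed win R
    let better ← cost 1 (decide (best.2 < c))
    if better then cost 2 (R, c) else cost 1 best

/-! ### The algorithm SPEEDUPW12 -/

/-- Windows in `W_1`, `W_2`, `W_3` are trimmed to their first, `j`-th, `k`-th full period. -/
def scheme₁ (j k : ℤ) : Scheme := fun ℓ =>
  if ℓ = 1 then some 1 else if ℓ = 2 then some j else if ℓ = 3 then some k else none

/-- Windows in `W_1`, `W_2` are trimmed to their first, `j`-th full period. -/
def scheme₂ (j : ℤ) : Scheme := fun ℓ =>
  if ℓ = 1 then some 1 else if ℓ = 2 then some j else none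

/-- Windows in `W_1` are trimmed to their full period. -/
def scheme₃ : Scheme := fun ℓ => if ℓ = 1 then some 1 else none

/-- SPEEDUPW12, based on the algorithm `A` for trimmed windows. -/
def speedupW12 {X : Type u} (A : TrimmedSolver X) {n : ℕ} (loc : Fin n → X) (win : Fin n → Window)
    (s : Speedup) : Timed (Run n) := do
  let empty ← buildArray fun _ : Fin n => cost 1 (none : Option ℝ)
  let best₁ ← forEach [0, 1] (empty, 0) fun best (i : ℕ) =>
    forEach [1, 2] best fun best (j : ℤ) =>
      forEach [1, 2, 3] best fun best (k : ℤ) =>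
        speedup A loc win s (1 / 2) (i / 4) (scheme₁ j k) best
  let best₂ ← forEach [0, 1, 2] best₁ fun best (i : ℕ) =>
    forEach [1, 2] best fun best (j : ℤ) =>
      speedup A loc win s (3 / 4) (i / 4) (scheme₂ j) best
  let best₃ ← forEach [0, 1, 2, 3] best₂ fun best (i : ℕ) =>
    speedup A loc win s 1 (i / 4) scheme₃ best
  cost 1 best₃.1

end Repairman

end

namespace Repairman

universe u

/-! ### Step-counted programs -/

/-! Of all the runs tried, those for periods of length 3/4, with `θ₀ = 0` and every trimmed window
cut to its first full period, already suffice: they give the ratio `5γ/2`, and `s² - 4s + 7 ≤ 16/5`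
for `7/3 ≤ s ≤ 17/7`.

A window in `W_3` for periods of length 1/2 is longer than 3/2 and at most 2 long, so it contains
one or two full periods of length 3/4, and its first one is always kept.

Compression (`exists_compressed_run`): at speed `s` a stretch of length `(s+1)/2 · α` of a run of
speed 1 takes time `(s+1)/(2s) · α`, and going back to where the next stretch begins, `α` after this
one, takes `(s-1)/(2s) · α`; together this is one period. For `s ≥ 7/3` and `α = 3/4` the stretches
have length at least 5/4.

Averaging (`two_mul_le_card_covered`, `two_mul_profitOn_le`): measure the service time from the
start of the first full period. It lies in `[-3/4, 2)`, and when the periods are shifted through all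
positions it sweeps an interval of length 3/4. Stretches `[-3/4, 1/2]`, `[3/4, 2]`, `[0, 5/4]` taken
with weights 2, 2, 1 cover every such interval with mean weight at least 2. The total weight is 5,
so some choice of stretch and shift captures at least 2/5 of the profit.

Finitely many shifts suffice (`exists_grid`): either every shift is equivalent to one that is tried,
or the `N` shifts form a grid on which half of `(s+1)N` is an integer, so that rounding 5/3 of `N`
up to whole cells costs nothing.

For the running time, the list of residues never exceeds the cap or the number of residues, which
for each of the three period lengths is at most 3 times that for length 1/2. -/

theorem bind_val {β δ : Type} (x : Timed β) (f : β → Timed δ) : (x >>= f).val = (f x.val).val := rfl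

theorem bind_steps {β δ : Type} (x : Timed β) (f : β → Timed δ) :
    (x >>= f).steps = x.steps + (f x.val).steps := rfl

theorem cost_val {β : Type} (k : ℕ) (a : β) : (cost k a).val = a := rfl

theorem cost_steps {β : Type} (k : ℕ) (a : β) : (cost k a).steps = k := rfl

theorem forEach_cons_val {σ β : Type} (b : β) (l : List β) (s : σ) (body : σ → β → Timed σ) :
    (forEach (b :: l) s body).val = (forEach l (body s b).val body).val := rfl

theorem forEach_cons_steps {σ β : Type} (b : β) (l : List β) (s : σ) (body : σ → β → Timed σ) :
    (forEach (b :: l) s body).steps =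
      (body s b).steps + (1 + (forEach l (body s b).val body).steps) := rfl

/-- An invariant that is restricted to the part of the list that has been processed. -/
theorem forEach_invariant {σ β : Type} {l : List β} {s : σ} {body : σ → β → Timed σ}
    (I : (β → Prop) → σ → Prop) (P : β → Prop) (hs : I P s)
    (h : ∀ P s b, I P s → I (fun x => P x ∨ x = b) (body s b).val) :
    I (fun x => P x ∨ x ∈ l) (forEach l s body).val := by
  induction l generalizing s P with
  | nil => simpa [forEach, cost_val] using hs
  | cons b l ih =>
    rw [forEach_cons_val]
    have := ih _ (h P s b hs)
    simpa [or_assoc] using this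

theorem forEach_preserves {σ β : Type} {l : List β} {s : σ} {body : σ → β → Timed σ}
    (I : σ → Prop) (hs : I s) (h : ∀ s b, I s → I (body s b).val) :
    I (forEach l s body).val :=
  forEach_invariant (fun _ => I) (fun _ => False) hs fun _ => h

/-- A property that is established by one round and kept by all rounds holds after the loop. -/
theorem forEach_establishes {σ β : Type} {l : List β} {s : σ} {body : σ → β → Timed σ}
    (I J : σ → Prop) {b : β} (hb : b ∈ l) (hs : I s) (h : ∀ s b, I s → I (body s b).val)
    (hJ : ∀ s, I s → J (body s b).val) (hk : ∀ s b, I s → J s → J (body s b).val) :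
    J (forEach l s body).val := by
  have := forEach_invariant (l := l) (s := s) (body := body)
    (fun P s => I s ∧ (P b → J s)) (fun _ => False) ⟨hs, False.elim⟩ (by
      rintro P s b' ⟨h1, h2⟩
      refine ⟨h s b' h1, ?_⟩
      rintro (h3 | rfl)
      · exact hk s b' h1 (h2 h3)
      · exact hJ s h1)
  exact this.2 (Or.inr hb)

theorem forEach_steps_le {σ β : Type} {l : List β} {s : σ} {body : σ → β → Timed σ}
    (I : σ → Prop) (B : ℕ) (hs : I s) (h : ∀ s b, I s → I (body s b).val)
    (hB : ∀ s b, I s → (body s b).steps ≤ B) :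
    (forEach l s body).steps ≤ l.length * (B + 1) + 1 := by
  induction l generalizing s with
  | nil => simp [forEach, cost_steps]
  | cons b l ih =>
    rw [forEach_cons_steps, List.length_cons, Nat.add_one_mul]
    have h1 := ih (h s b hs)
    have h2 := hB s b hs
    omega

theorem forEach_steps_le' {σ β : Type} {l : List β} {s : σ} {body : σ → β → Timed σ}
    (B : ℕ) (hB : ∀ s b, (body s b).steps ≤ B) :
    (forEach l s body).steps ≤ l.length * (B + 1) + 1 :=
  forEach_steps_le (fun _ => True) B trivial (fun _ _ _ => trivial) fun s b _ => hB s b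

/-! ### Counting the profit -/

theorem countServed_val {n : ℕ} (win : Fin n → Window) (R : Run n) :
    (countServed win R).val = profit win R := by
  classical
  have key : ∀ (l : List (Fin n)) (c : ℕ),
      (forEach l c fun c i =>
        match R i with
        | none => cost 1 c
        | some t => do
            let b ← cost 3 (decide ((win i).release ≤ t) && decide (t < (win i).deadline))
            if b then cost 1 (c + 1) else cost 1 c).val =
      c + (l.map fun i => if i ∈ served win R then 1 else 0).sum := by
    intro l
    induction l with
    | nil => intro c; simp [forEach, cost_val]
    | cons i l ih =>
      intro c
      rw [forEach_cons_val, ih, List.map_cons, List.sum_cons, ← add_assoc]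
      congr 1
      cases hR : R i with
      | none => simp [cost_val, served, hR]
      | some t =>
        simp only [bind_val, cost_val]
        by_cases h1 : (win i).release ≤ t <;> by_cases h2 : t < (win i).deadline <;>
          simp [served, hR, h1, h2, cost_val]
  refine (key (List.finRange n) 0).trans ?_
  rw [zero_add, ← Fin.sum_univ_def, profit, Set.ncard_eq_toFinset_card',
    Finset.sum_boole, Nat.cast_id]
  congr 1
  ext i
  simp

theorem countServed_steps {n : ℕ} (win : Fin n → Window) (R : Run n) :
    (countServed win R).steps ≤ n * 5 + 1 := by
  have := forEach_steps_le' (l := List.finRange n) (s := 0) (body := fun c i =>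
        match R i with
        | none => cost 1 c
        | some t => do
            let b ← cost 3 (decide ((win i).release ≤ t) && decide (t < (win i).deadline))
            if b then cost 1 (c + 1) else cost 1 c) 4 (by
      intro c i
      cases R i with
      | none => simp [cost_steps]
      | some t =>
        simp only [bind_steps, cost_steps, cost_val]
        cases decide ((win i).release ≤ t) && decide (t < (win i).deadline) <;>
          simp [cost_steps])
  rw [List.length_finRange] at this
  exact this

/-! ### Trimming -/

theorem trim_val (α θ : ℝ) (scheme : Scheme) (w : Window) :
    (trim α θ scheme w).val = (scheme (lastPeriod α θ w - firstPeriod α θ w)).map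
      fun k => firstPeriod α θ w + k - 1 := by
  simp only [trim, bind_val, cost_val]
  cases scheme (lastPeriod α θ w - firstPeriod α θ w) <;> rfl

theorem trim_steps (α θ : ℝ) (scheme : Scheme) (w : Window) :
    (trim α θ scheme w).steps ≤ 13 := by
  simp only [trim, bind_steps, cost_val, cost_steps]
  cases scheme (lastPeriod α θ w - firstPeriod α θ w) <;> simp [cost_steps]

/-! ### Residues -/

theorem residue_add_int_mul {α : ℝ} (hα : 0 < α) (x : ℝ) (z : ℤ) :
    residue α (x + z * α) = residue α x := by
  have : (x + z * α) / α = x / α + z := by field_simp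
  rw [residue, residue, this, Int.floor_add_intCast]
  push_cast
  ring

theorem residue_nonneg {α : ℝ} (hα : 0 < α) (x : ℝ) : 0 ≤ residue α x := by
  have := Int.floor_le (x / α)
  rw [le_div_iff₀ hα] at this
  rw [residue]
  linarith

theorem residue_lt {α : ℝ} (hα : 0 < α) (x : ℝ) : residue α x < α := by
  have := Int.lt_floor_add_one (x / α)
  rw [div_lt_iff₀ hα] at this
  rw [residue]
  linarith

/-- The residues of all release times and deadlines. -/
def residues {n : ℕ} (α : ℝ) (win : Fin n → Window) : Set ℝ :=
  Set.range (fun i => residue α (win i).release) ∪ Set.range (fun i => residue α (win i).deadline)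

theorem residues_finite {n : ℕ} (α : ℝ) (win : Fin n → Window) : (residues α win).Finite :=
  (Set.finite_range _).union (Set.finite_range _)

theorem numPeriodSets_eq {n : ℕ} (α : ℝ) (win : Fin n → Window) :
    numPeriodSets α win = (residues α win).ncard := rfl

theorem numPeriodSets_pos {n : ℕ} (hn : 0 < n) (α : ℝ) (win : Fin n → Window) :
    0 < numPeriodSets α win := by
  rw [numPeriodSets_eq, Set.ncard_pos (residues_finite α win)]
  exact ⟨_, Or.inl ⟨⟨0, hn⟩, rfl⟩⟩

/-- Adding a multiple of `d * β = z * α` leaves the residue modulo `α` alone, so that residue is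
determined by the residue modulo `β` together with `⌊x / β⌋` modulo `d`. -/
theorem numPeriodSets_le {n : ℕ} (win : Fin n → Window) {α β : ℝ} (hα : 0 < α)
    {d z : ℕ} (hd : 0 < d) (h : d * β = z * α) :
    numPeriodSets α win ≤ d * numPeriodSets β win := by
  classical
  have key : ∀ x, ∃ j ∈ Finset.range d, residue α (residue β x + j * β) = residue α x := by
    intro x
    refine ⟨(⌊x / β⌋ % d).toNat, ?_, ?_⟩
    · rw [Finset.mem_range]
      have := Int.emod_lt_of_pos ⌊x / β⌋ (Int.natCast_pos.2 hd)
      have := Int.emod_nonneg ⌊x / β⌋ (Int.natCast_pos.2 hd).ne'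
      omega
    · have h1 : (((⌊x / β⌋ % d).toNat : ℤ)) = ⌊x / β⌋ % d :=
        Int.toNat_of_nonneg (Int.emod_nonneg _ (Int.natCast_pos.2 hd).ne')
      have h2 : (((⌊x / β⌋ % d).toNat : ℕ) : ℝ) = ⌊x / β⌋ - d * ⌊x / β / d⌋ := by
        rw [← Int.cast_natCast, h1, Int.emod_def]
        push_cast
        congr 3
        rw [Int.floor_div_natCast]
      rw [← residue_add_int_mul hα _ (z * ⌊x / β / d⌋), h2]
      congr 1
      rw [residue]
      push_cast
      linear_combination (-(⌊x / β / d⌋ : ℝ)) * h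
  have hfin := residues_finite β win
  have hsub : residues α win ⊆ ((hfin.toFinset ×ˢ Finset.range d).image
      fun yj : ℝ × ℕ => residue α (yj.1 + yj.2 * β) : Finset ℝ) := by
    rintro _ (⟨i, rfl⟩ | ⟨i, rfl⟩)
    · obtain ⟨j, hj, h⟩ := key (win i).release
      rw [Finset.mem_coe, Finset.mem_image]
      exact ⟨(_, j), Finset.mem_product.2 ⟨hfin.mem_toFinset.2 (Or.inl ⟨i, rfl⟩), hj⟩, h⟩
    · obtain ⟨j, hj, h⟩ := key (win i).deadline
      rw [Finset.mem_coe, Finset.mem_image]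
      exact ⟨(_, j), Finset.mem_product.2 ⟨hfin.mem_toFinset.2 (Or.inr ⟨i, rfl⟩), hj⟩, h⟩
  rw [numPeriodSets_eq, numPeriodSets_eq]
  refine (Set.ncard_le_ncard hsub (Finset.finite_toSet _)).trans ?_
  rw [Set.ncard_coe_finset, Set.ncard_eq_toFinset_card _ hfin, mul_comm]
  exact Finset.card_image_le.trans (by rw [Finset.card_product, Finset.card_range])

/-! ### The list of residues -/

theorem search_val (x : ℝ) (l : List ℝ) : (search x l).val = decide (x ∈ l) := by
  induction l with
  | nil => simp [search, cost_val]
  | cons y l ih =>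
    simp only [search, bind_val, cost_val]
    by_cases h : x = y <;> simp [h, cost_val, ih]

theorem search_steps (x : ℝ) (l : List ℝ) : (search x l).steps ≤ 2 * l.length + 1 := by
  induction l with
  | nil => simp [search, cost_steps]
  | cons y l ih =>
    simp only [search, bind_steps, cost_val, cost_steps, List.length_cons]
    by_cases h : x = y
    · simp [h, cost_steps]
    · simp only [h, decide_false, Bool.false_eq_true, if_false]; omega

open Classical in
theorem insertResidue_val (α : ℝ) (cap : ℕ∞) (l : List ℝ) (c : ℕ) (x : ℝ) :
    (insertResidue α cap (some (l, c)) x).val =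
      if residue α x ∈ l then some (l, c) else if cap ≤ c then none
        else some (residue α x :: l, c + 1) := by
  simp only [insertResidue, bind_val, cost_val, search_val]
  by_cases hm : residue α x ∈ l <;> by_cases hc : cap ≤ c <;> simp [hm, hc, bind_val, cost_val]

/-- The state of the computation of the residues in `Q` after those of the times in `P`. -/
def ResidueState (α : ℝ) (cap : ℕ∞) (Q : Set ℝ) (P : ℝ → Prop) : Option (List ℝ × ℕ) → Prop
  | none => cap < Q.ncard
  | some (l, c) => c = l.length ∧ l.Nodup ∧ (∀ y ∈ l, y ∈ Q) ∧ (c : ℕ∞) ≤ cap ∧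
      ∀ x, P x → residue α x ∈ l

theorem ResidueState.mono {α : ℝ} {cap : ℕ∞} {Q : Set ℝ} {P P' : ℝ → Prop}
    {st : Option (List ℝ × ℕ)} (h : ResidueState α cap Q P st) (hP : ∀ x, P' x → P x) :
    ResidueState α cap Q P' st := by
  match st, h with
  | none, h => exact h
  | some (l, c), ⟨h1, h2, h3, h4, h5⟩ => exact ⟨h1, h2, h3, h4, fun x hx => h5 x (hP x hx)⟩

theorem ResidueState.length_le {α : ℝ} {cap : ℕ∞} {Q : Set ℝ} (hQ : Q.Finite) {P : ℝ → Prop}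
    {l : List ℝ} {c : ℕ} (h : ResidueState α cap Q P (some (l, c))) : l.length ≤ Q.ncard := by
  classical
  obtain ⟨-, h2, h3, -⟩ := h
  rw [← List.toFinset_card_of_nodup h2, ← Set.ncard_coe_finset]
  exact Set.ncard_le_ncard (fun y hy => h3 y (by simpa using hy)) hQ

theorem ResidueState.insert {α : ℝ} {cap : ℕ∞} {Q : Set ℝ} (hQ : Q.Finite) {P : ℝ → Prop}
    {st : Option (List ℝ × ℕ)} (h : ResidueState α cap Q P st) {x : ℝ} (hx : residue α x ∈ Q) :
    ResidueState α cap Q (fun y => P y ∨ y = x) (insertResidue α cap st x).val := by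
  classical
  match st, h with
  | none, h => exact h
  | some (l, c), h =>
    obtain ⟨h1, h2, h3, h4, h5⟩ := h
    rw [insertResidue_val]
    split_ifs with hm hc
    · refine ⟨h1, h2, h3, h4, ?_⟩
      rintro y (hy | rfl)
      exacts [h5 y hy, hm]
    -- Giving up is justified: the list with the new residue consists of `c + 1` different members
    -- of `Q`, and `cap ≤ c`.
    · refine lt_of_le_of_lt hc ?_
      rw [Nat.cast_lt, h1]
      have hn : (residue α x :: l).Nodup := List.nodup_cons.2 ⟨hm, h2⟩
      rw [← Nat.succ_le_iff, ← Nat.add_one, ← List.length_cons (a := residue α x),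
        ← List.toFinset_card_of_nodup hn, ← Set.ncard_coe_finset]
      refine Set.ncard_le_ncard (fun y hy => ?_) hQ
      rw [Finset.mem_coe, List.mem_toFinset, List.mem_cons] at hy
      rcases hy with rfl | hy
      exacts [hx, h3 y hy]
    · refine ⟨by simp [h1], List.nodup_cons.2 ⟨hm, h2⟩, ?_, ?_, ?_⟩
      · intro y hy
        rcases List.mem_cons.1 hy with rfl | hy
        exacts [hx, h3 y hy]
      · rw [Nat.cast_add, Nat.cast_one]
        exact Order.add_one_le_of_lt (not_le.1 hc)
      · rintro y (hy | rfl)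
        exacts [List.mem_cons_of_mem _ (h5 y hy), List.mem_cons_self]

/-- `D` stands for the minimum of the cap and the number of residues; the list searched is never
longer than either. -/
theorem insertResidue_steps {α : ℝ} {cap : ℕ∞} {Q : Set ℝ} (hQ : Q.Finite) {P : ℝ → Prop}
    {st : Option (List ℝ × ℕ)} (h : ResidueState α cap Q P st) (x : ℝ) {D : ℕ}
    (hD : ∀ c : ℕ, (c : ℕ∞) ≤ cap → c ≤ Q.ncard → c ≤ D) :
    (insertResidue α cap st x).steps ≤ 2 * D + 8 := by
  match st, h with
  | none, h => simp [insertResidue, cost_steps]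
  | some (l, c), h =>
    have hl := hD _ (h.1 ▸ h.2.2.2.1) (h.length_le hQ)
    have := search_steps (residue α x) l
    simp only [insertResidue, bind_steps, cost_val, cost_steps]
    cases (search (residue α x) l).val <;> by_cases hc : cap ≤ c <;>
      simp [hc, bind_steps, cost_val, cost_steps] <;> omega

theorem distinctResidues_state {n : ℕ} (α : ℝ) (cap : ℕ∞) (win : Fin n → Window) :
    ResidueState α cap (residues α win)
      (fun x => ∃ i, x = (win i).release ∨ x = (win i).deadline)
      (distinctResidues α cap win).val := by
  have := forEach_invariant (l := List.finRange n) (s := some ([], 0))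
    (body := fun st i => do
      let st' ← insertResidue α cap st (win i).release
      insertResidue α cap st' (win i).deadline)
    (fun P st => ResidueState α cap (residues α win)
      (fun x => ∃ i, P i ∧ (x = (win i).release ∨ x = (win i).deadline)) st)
    (fun _ => False) (by simp [ResidueState]) (by
      intro P st i h
      have h1 := (h.insert (residues_finite α win) (x := (win i).release)
        (Or.inl ⟨i, rfl⟩)).insert (residues_finite α win) (x := (win i).deadline)
        (Or.inr ⟨i, rfl⟩)
      refine h1.mono ?_
      rintro x ⟨j, hj | rfl, hx⟩
      · exact Or.inl (Or.inl ⟨j, hj, hx⟩)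
      · rcases hx with hx | hx
        exacts [Or.inl (Or.inr hx), Or.inr hx])
  exact this.mono fun x ⟨i, hi⟩ => ⟨i, Or.inr (List.mem_finRange i), hi⟩

theorem distinctResidues_steps {n : ℕ} (α : ℝ) (cap : ℕ∞) (win : Fin n → Window) {D : ℕ}
    (hD : ∀ c : ℕ, (c : ℕ∞) ≤ cap → c ≤ numPeriodSets α win → c ≤ D) :
    (distinctResidues α cap win).steps ≤ n * (4 * D + 17) + 1 := by
  have hQ := residues_finite α win
  have := forEach_steps_le (l := List.finRange n) (s := some ([], 0))
    (body := fun st i => do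
      let st' ← insertResidue α cap st (win i).release
      insertResidue α cap st' (win i).deadline)
    (ResidueState α cap (residues α win) fun _ => False) (4 * D + 16) (by simp [ResidueState])
    (fun st i h => ((h.insert hQ (Or.inl ⟨i, rfl⟩)).insert hQ (Or.inr ⟨i, rfl⟩)).mono
      fun x hx => hx.elim)
    (fun st i h => by
      have h1 := insertResidue_steps hQ h (win i).release hD
      have h2 := insertResidue_steps hQ (h.insert hQ (x := (win i).release) (Or.inl ⟨i, rfl⟩))
        (win i).deadline hD
      rw [bind_steps]
      omega)
  rw [List.length_finRange] at this
  exact this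

theorem gridPoints_length (α θ₀ : ℝ) (r : ℕ) : (gridPoints α θ₀ r).val.length = r := by
  have key : ∀ (l : List ℕ) (l' : List ℝ),
      (forEach l l' fun l c => cost 4 ((θ₀ + c * α / r) :: l)).val.length =
        l.length + l'.length := by
    intro l
    induction l with
    | nil => intro l'; simp [forEach, cost_val]
    | cons c l ih =>
      intro l'
      rw [forEach_cons_val, ih, cost_val, List.length_cons, List.length_cons]
      omega
  rw [gridPoints, key]
  simp

theorem mem_gridPoints (α θ₀ : ℝ) {r k : ℕ} (hk : k < r) :
    θ₀ + k * α / r ∈ (gridPoints α θ₀ r).val :=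
  forEach_establishes (fun _ => True) (fun l => θ₀ + k * α / r ∈ l) (List.mem_range.2 hk)
    trivial (fun _ _ _ => trivial) (fun _ _ => List.mem_cons_self)
    fun _ _ _ h => List.mem_cons_of_mem _ h

theorem gridPoints_steps (α θ₀ : ℝ) (r : ℕ) : (gridPoints α θ₀ r).steps ≤ r * 5 + 1 := by
  have := forEach_steps_le' (l := List.range r) (s := ([] : List ℝ))
    (body := fun l c => cost 4 ((θ₀ + c * α / r) :: l)) 4 (fun _ _ => le_rfl)
  rw [List.length_range] at this
  exact this

/-! ### The starting points -/

/-- The search gives up only after finding more residues than the cap, so the grid is used only when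
the cap is finite. -/
theorem startingPoints_val {n : ℕ} (s : Speedup) (α θ₀ : ℝ) (win : Fin n → Window) :
    (∀ i, residue α (win i).release ∈ (startingPoints s α θ₀ win).val ∧
      residue α (win i).deadline ∈ (startingPoints s α θ₀ win).val) ∨
    (∃ N : ℕ, s.shifts = N ∧
      (startingPoints s α θ₀ win).val = (gridPoints α θ₀ N).val) := by
  have h := distinctResidues_state α s.shifts win
  simp only [startingPoints, bind_val, cost_val]
  generalize (distinctResidues α s.shifts win).val = st at h
  match st, h with
  | none, h =>
    right
    obtain ⟨N, hN⟩ := ENat.ne_top_iff_exists.1 (ne_top_of_lt h)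
    exact ⟨N, hN.symm, by rw [← hN]; rfl⟩
  | some (l, c), h =>
    exact Or.inl fun i => ⟨h.2.2.2.2 _ ⟨i, Or.inl rfl⟩, h.2.2.2.2 _ ⟨i, Or.inr rfl⟩⟩

theorem startingPoints_bounds {n : ℕ} (s : Speedup) (α θ₀ : ℝ) (win : Fin n → Window) {D : ℕ}
    (hD : ∀ c : ℕ, (c : ℕ∞) ≤ s.shifts → c ≤ numPeriodSets α win → c ≤ D) :
    (startingPoints s α θ₀ win).val.length ≤ D ∧
      (startingPoints s α θ₀ win).steps ≤ n * (4 * D + 17) + 5 * D + 6 := by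
  have h := distinctResidues_state α s.shifts win
  have h2 := distinctResidues_steps α s.shifts win hD
  simp only [startingPoints, bind_val, cost_val, bind_steps, cost_steps]
  generalize distinctResidues α s.shifts win = x at h h2
  obtain ⟨st, k⟩ := x
  match st, h with
  | none, h =>
    obtain ⟨N, hN⟩ := ENat.ne_top_iff_exists.1 (ne_top_of_lt h)
    have h : s.shifts < (numPeriodSets α win : ℕ∞) := h
    have hN' : N ≤ D := hD N hN.le (by rw [← hN] at h; exact_mod_cast h.le)
    have h3 := gridPoints_steps α θ₀ N
    simp only [← hN, ENat.toNat_natCast, gridPoints_length]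
    exact ⟨hN', by simp only at h2; omega⟩
  | some (l, c), h =>
    have hl : l.length ≤ D := hD _ (h.1 ▸ h.2.2.2.1) (h.length_le (residues_finite α win))
    simp only [cost_val, cost_steps] at h2 ⊢
    exact ⟨hl, by omega⟩

/-! ### Compressing a run -/

/-- The times `k * α + y` and `k * α + y / s` of two services in periods that are `k` apart: within
each period the repairman travels forward along a stretch of length at most `(s + 1) / 2 * α` and
returns as far as is needed. -/
theorem abs_add_le_mul_abs_add_div {s α y y' : ℝ} (hs : 1 ≤ s) (hα : 0 < α)
    (hy : 0 ≤ y) (hy' : 0 ≤ y') (hyl : y ≤ (s + 1) / 2 * α) (hyl' : y' ≤ (s + 1) / 2 * α)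
    (k : ℤ) : |k * α + (y - y')| ≤ s * |k * α + (y - y') / s| := by
  have hs0 : 0 < s := by linarith
  have e : s * |k * α + (y - y') / s| = |s * (k * α) + (y - y')| := by
    rw [← abs_of_pos hs0, ← abs_mul, abs_of_pos hs0]
    congr 1
    field_simp
  rw [e]
  -- With `d = y - y'` and `k ≥ 1`, the bound `|kα + d| ≤ skα + d` amounts to `s ≥ 1` and `2d ≥ -(s
  -- + 1)kα`; the case `k ≤ -1` is its mirror image, and for `k = 0` both sides agree.
  rcases lt_trichotomy k 0 with hk | rfl | hk
  · have h1 : (k : ℝ) ≤ -1 := by exact_mod_cast Int.le_sub_one_of_lt hk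
    have h2 : k * α ≤ -1 * α := mul_le_mul_of_nonneg_right h1 hα.le
    have h3 : s * (k * α) ≤ 1 * (k * α) := mul_le_mul_of_nonpos_right hs (by linarith)
    have h4 : (s + 1) * (k * α) ≤ (s + 1) * (-1 * α) := mul_le_mul_of_nonneg_left h2 (by linarith)
    refine le_trans ?_ (neg_le_abs _)
    rw [abs_le]
    constructor <;> nlinarith
  · simp
  · have h1 : (1 : ℝ) ≤ k := by exact_mod_cast hk
    have h2 : 1 * α ≤ k * α := mul_le_mul_of_nonneg_right h1 hα.le
    have h3 : 1 * (k * α) ≤ s * (k * α) := mul_le_mul_of_nonneg_right hs (by linarith)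
    have h4 : (s + 1) * (1 * α) ≤ (s + 1) * (k * α) := mul_le_mul_of_nonneg_left h2 (by linarith)
    refine le_trans ?_ (le_abs_self _)
    rw [abs_le]
    constructor <;> nlinarith

/-- A run of speed 1 whose services in `G` lie in the stretches of length `(s + 1) / 2 * α` that
begin at the times `a + p i * α` gives a run of speed `s` that services the same requests in the
periods with the numbers `p i`. -/
theorem exists_compressed_run {X : Type u} [MetricSpace X] {n : ℕ} {loc : Fin n → X} {R : Run n}
    (hR : Feasible loc 1 R) {s α : ℝ} (hs : 1 < s) (hα : 0 < α) (a θ : ℝ) (p : Fin n → ℤ)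
    (G : Set (Fin n))
    (hG : ∀ i ∈ G, ∃ t, R i = some t ∧ a + p i * α ≤ t ∧ t ≤ a + p i * α + (s + 1) / 2 * α) :
    ∃ R' : Run n, Feasible loc s R' ∧
      ∀ i ∈ G, ∃ t, R' i = some t ∧ θ + p i * α ≤ t ∧ t < θ + (p i + 1) * α := by
  classical
  have hs0 : 0 < s := by linarith
  refine ⟨fun i => if i ∈ G then (R i).map fun t => θ + p i * α + (t - a - p i * α) / s else none,
    ?_, ?_⟩
  · intro i j t u hi hj
    by_cases hiG : i ∈ G
    · by_cases hjG : j ∈ G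
      · obtain ⟨t', ht', h1, h2⟩ := hG i hiG
        obtain ⟨u', hu', h3, h4⟩ := hG j hjG
        simp only [hiG, hjG, if_true, ht', hu', Option.map_some, Option.some.injEq] at hi hj
        have h5 := hR i j t' u' ht' hu'
        have h6 := abs_add_le_mul_abs_add_div (y := t' - a - p i * α) (y' := u' - a - p j * α)
          hs.le hα (by linarith) (by linarith) (by linarith) (by linarith) (p i - p j)
        rw [one_mul] at h5
        have e1 : t' - u' = (p i - p j : ℤ) * α +
            ((t' - a - p i * α) - (u' - a - p j * α)) := by push_cast; ring
        have e2 : t - u = (p i - p j : ℤ) * α +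
            ((t' - a - p i * α) - (u' - a - p j * α)) / s := by
          rw [← hi, ← hj]; push_cast; ring
        rw [e1] at h5
        rw [e2]
        exact h5.trans h6
      · simp [hjG] at hj
    · simp [hiG] at hi
  · intro i hiG
    obtain ⟨t, ht, h1, h2⟩ := hG i hiG
    refine ⟨θ + p i * α + (t - a - p i * α) / s, by simp [hiG, ht], ?_, ?_⟩
    · have : 0 ≤ (t - a - p i * α) / s := div_nonneg (by linarith) hs0.le
      linarith
    -- Strict because `(s + 1) / 2 < s`; this keeps the service inside the half-open period.
    · have : (t - a - p i * α) / s < α := by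
        rw [div_lt_iff₀ hs0]
        nlinarith
      linarith

/-! ### Equivalent sets of periods -/

/-- The divisions of two sets of periods separate the endpoints of the windows in the same way. -/
def SamePeriods {n : ℕ} (α : ℝ) (win : Fin n → Window) (θ θ' : ℝ) : Prop :=
  ∃ z : ℤ, ∀ i, firstPeriod α θ' (win i) = firstPeriod α θ (win i) + z ∧
    lastPeriod α θ' (win i) = lastPeriod α θ (win i) + z

theorem samePeriods_refl {n : ℕ} (α : ℝ) (win : Fin n → Window) (θ : ℝ) :
    SamePeriods α win θ θ :=
  ⟨0, fun _ => by simp⟩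

/-- Moving the starting point up to the next position of an endpoint does not change the periods
that are contained in windows. -/
theorem exists_samePeriods {n : ℕ} (hn : 0 < n) {α : ℝ} (hα : 0 < α) (win : Fin n → Window)
    {l : List ℝ} (hl : ∀ i, residue α (win i).release ∈ l ∧ residue α (win i).deadline ∈ l)
    (θ : ℝ) : ∃ θ' ∈ l, SamePeriods α win θ θ' := by
  classical
  have hne : l.toFinset.Nonempty := ⟨_, List.mem_toFinset.2 (hl ⟨0, hn⟩).1⟩
  -- `ρ` is the first endpoint position met when `θ` moves up. A division may come to lie on an
  -- endpoint: the conventions `release < division` and `division ≤ deadline` make this harmless.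
  obtain ⟨ρ, hρ, hmin⟩ := l.toFinset.exists_min_image (fun ρ => residue α (ρ - θ)) hne
  rw [List.mem_toFinset] at hρ
  refine ⟨ρ, hρ, -⌊(ρ - θ) / α⌋, ?_⟩
  have key : ∀ x, residue α x ∈ l → ⌊(x - ρ) / α⌋ = ⌊(x - θ) / α⌋ + -⌊(ρ - θ) / α⌋ := by
    intro x hx
    have h1 := hmin _ (List.mem_toFinset.2 hx)
    have h2 : residue α (residue α x - θ) = residue α (x - θ) := by
      rw [← residue_add_int_mul hα _ ⌊x / α⌋, residue.eq_def α x]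
      congr 1
      ring
    rw [h2] at h1
    have h3 := residue_lt hα (x - θ)
    have h4 := residue_nonneg hα (ρ - θ)
    rw [residue, residue] at h1
    rw [residue] at h3 h4
    rw [Int.floor_eq_iff]
    push_cast
    rw [le_div_iff₀ hα, div_lt_iff₀ hα]
    constructor <;> linarith
  intro i
  rw [firstPeriod, firstPeriod, lastPeriod, lastPeriod, key _ (hl i).1, key _ (hl i).2]
  exact ⟨by ring, rfl⟩

/-! ### Periods of length 3/4 -/

theorem firstPeriod_spec {α : ℝ} (hα : 0 < α) (θ : ℝ) (w : Window) :
    w.release < θ + firstPeriod α θ w * α ∧ θ + firstPeriod α θ w * α ≤ w.release + α := by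
  have h1 := Int.floor_le ((w.release - θ) / α)
  have h2 := Int.lt_floor_add_one ((w.release - θ) / α)
  rw [le_div_iff₀ hα] at h1
  rw [div_lt_iff₀ hα] at h2
  rw [firstPeriod]
  push_cast
  constructor <;> linarith

theorem lastPeriod_spec {α : ℝ} (hα : 0 < α) (θ : ℝ) (w : Window) :
    θ + lastPeriod α θ w * α ≤ w.deadline ∧ w.deadline < θ + (lastPeriod α θ w + 1) * α := by
  have h1 := Int.floor_le ((w.deadline - θ) / α)
  have h2 := Int.lt_floor_add_one ((w.deadline - θ) / α)
  rw [le_div_iff₀ hα] at h1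
  rw [div_lt_iff₀ hα] at h2
  rw [lastPeriod]
  constructor <;> linarith

theorem length_of_inW_three {θ : ℝ} {w : Window} (h : InW 3 (1 / 2) θ w) :
    3 / 2 < w.deadline - w.release := by
  have hα : (0 : ℝ) < 1 / 2 := by norm_num
  rw [InW, fullPeriods_eq hα, ← Finset.coe_Ico, Set.ncard_coe_finset, Int.card_Ico] at h
  have h1 : lastPeriod (1 / 2) θ w = firstPeriod (1 / 2) θ w + 3 := by omega
  have h2 := (firstPeriod_spec hα θ w).1
  have h3 := (lastPeriod_spec hα θ w).1
  rw [h1] at h3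
  push_cast at h3
  linarith

/-- A length above 3/2, two periods, forces a full period, and a length of at most 2 < 9/4 leaves no
room for three. Hence `scheme₂ 1` never drops such a window. -/
theorem lastPeriod_sub_firstPeriod {w : Window} (h1 : 3 / 2 < w.deadline - w.release)
    (h2 : w.deadline - w.release ≤ 2) (θ : ℝ) :
    lastPeriod (3 / 4) θ w - firstPeriod (3 / 4) θ w = 1 ∨
      lastPeriod (3 / 4) θ w - firstPeriod (3 / 4) θ w = 2 := by
  have hα : (0 : ℝ) < 3 / 4 := by norm_num
  obtain ⟨h3, h4⟩ := firstPeriod_spec hα θ w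
  obtain ⟨h5, h6⟩ := lastPeriod_spec hα θ w
  have h7 : (0 : ℝ) < (lastPeriod (3 / 4) θ w - firstPeriod (3 / 4) θ w : ℤ) := by
    push_cast; linarith
  have h8 : ((lastPeriod (3 / 4) θ w - firstPeriod (3 / 4) θ w : ℤ) : ℝ) < (3 : ℤ) := by
    push_cast; linarith
  have h7' := Int.cast_pos.1 h7
  have h8' := Int.cast_lt.1 h8
  omega

/-! ### Averaging over shifted sets of periods -/

/-- In a window of `N` consecutive cells at least `2 / 5` are covered on average by the stretches of
`m` cells that begin at `-N` (counted twice), at `K - m` (counted twice) and at `0`. -/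
theorem two_mul_le_card_covered {N : ℕ} {m K e Y : ℤ} (hm : 5 * N ≤ 3 * m) (hm' : 3 * m ≤ 5 * N + 2)
    (hK : 8 * N ≤ 3 * K) (hK' : 3 * K ≤ 8 * N + 2) (hY : e - 1 ≤ Y) (hY' : Y - e < K) :
    2 * N ≤ 2 * ((Finset.Ico e (e + N)).filter fun x => -(N : ℤ) ≤ Y - x ∧ Y - x < -N + m).card +
      2 * ((Finset.Ico e (e + N)).filter fun x => K - m ≤ Y - x ∧ Y - x < K - m + m).card +
      ((Finset.Ico e (e + N)).filter fun x => 0 ≤ Y - x ∧ Y - x < 0 + m).card := by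
  have key : ∀ a : ℤ, ((Finset.Ico e (e + N)).filter fun x => a ≤ Y - x ∧ Y - x < a + m).card =
      (min (e + N) (Y - a + 1) - max e (Y - a - m + 1)).toNat := by
    intro a
    rw [← Int.card_Ico]
    congr 1
    ext x
    simp only [Finset.mem_filter, Finset.mem_Ico, lt_min_iff, max_le_iff]
    omega
  rw [key, key, key]
  -- The bounds force `K = m + N`. The weights are 2 on `[-N, 0)`, 3 on `[0, m - N)`, 1 on `[m - N,
  -- N)`, 3 on `[N, m)` and 2 on `[m, K)`. The gap of weight 1 has at most `N / 3` cells and is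
  -- flanked by at least `2N / 3` cells of weight 3 on either side, which make up for it in any
  -- interval of `N` cells.
  omega

/-- The numbers `k + p k * N` for `k = 0, …, N - 1` fill any interval of `N` integers that
contains them all. -/
theorem card_filter_range_eq {N : ℕ} (p : ℕ → ℤ) (e : ℤ)
    (h : ∀ k < N, e ≤ k + p k * N ∧ k + p k * N < e + N) (P : ℤ → Prop) [DecidablePred P] :
    ((Finset.range N).filter fun k => P (k + p k * N)).card =
      ((Finset.Ico e (e + N)).filter P).card := by
  classical
  have hinj : Set.InjOn (fun k : ℕ => (k : ℤ) + p k * N) (Finset.range N : Set ℕ) := by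
    intro k hk k' hk' heq
    -- `k` is recovered as the residue modulo `N`.
    have h1 : (k : ℤ) % N = k' % N := by
      have := congrArg (· % (N : ℤ)) heq
      simpa using this
    rw [Int.emod_eq_of_lt (by omega) (by exact_mod_cast Finset.mem_range.1 hk),
      Int.emod_eq_of_lt (by omega) (by exact_mod_cast Finset.mem_range.1 hk')] at h1
    exact_mod_cast h1
  have himg : (Finset.range N).image (fun k : ℕ => (k : ℤ) + p k * N) = Finset.Ico e (e + N) := by
    refine Finset.eq_of_subset_of_card_le ?_ ?_
    · intro x hx
      obtain ⟨k, hk, rfl⟩ := Finset.mem_image.1 hx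
      exact Finset.mem_Ico.2 (h k (Finset.mem_range.1 hk))
    · rw [Finset.card_image_of_injOn hinj, Int.card_Ico, Finset.card_range]
      omega
  rw [← himg, Finset.filter_image, Finset.card_image_of_injOn
    (hinj.mono (by exact_mod_cast Finset.filter_subset _ _))]

/-! ### SPEEDUP -/

/-- The best run so far has speed `v` and comes with its profit. -/
def IsBest {X : Type u} [MetricSpace X] {n : ℕ} (loc : Fin n → X) (win : Fin n → Window) (v : ℝ)
    (best : Run n × ℕ) : Prop :=
  Feasible loc v best.1 ∧ best.2 = profit win best.1

/-- The trimmed windows for periods of length `α` with starting point `θ`. -/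
noncomputable def trimmed {n : ℕ} (win : Fin n → Window) (α θ : ℝ) (scheme : Scheme) : Trimmed n :=
  ⟨α, θ, fun i => (trim α θ scheme (win i)).val⟩

/-- The last clause measures each run of the solver on the original windows, since that is the
profit by which SPEEDUP compares runs. -/
theorem speedup_spec {X : Type u} [MetricSpace X] {A : TrimmedSolver X} {γ : ℝ} (hA : A.HasRatio γ)
    {n : ℕ} (loc : Fin n → X) (win : Fin n → Window) {s : Speedup} (hs : 0 < s.val) {α : ℝ}
    (hα : 0 < α) (θ₀ : ℝ) (scheme : Scheme) {best : Run n × ℕ} (hb : IsBest loc win s.val best) :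
    IsBest loc win s.val (speedup A loc win s α θ₀ scheme best).val ∧
      best.2 ≤ (speedup A loc win s α θ₀ scheme best).val.2 ∧
      ∀ θ ∈ (startingPoints s α θ₀ win).val,
        profit win (A n loc s.val (trimmed win α θ scheme)).val ≤
          (speedup A loc win s α θ₀ scheme best).val.2 := by
  set body : Run n × ℕ → ℝ → Timed (Run n × ℕ) := fun best θ => do
    let idx ← buildArray fun i => trim α θ scheme (win i)
    let R ← A n loc s.val ⟨α, θ, idx⟩
    let c ← countServed win R
    let better ← cost 1 (decide (best.2 < c))
    if better then cost 2 (R, c) else cost 1 best with hbody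
  have hval : ∀ best θ, (body best θ).val =
      if best.2 < profit win (A n loc s.val (trimmed win α θ scheme)).val then
        ((A n loc s.val (trimmed win α θ scheme)).val,
          profit win (A n loc s.val (trimmed win α θ scheme)).val) else best := by
    intro best θ
    simp only [hbody, bind_val, cost_val, countServed_val]
    by_cases h : best.2 < profit win (A n loc s.val (trimmed win α θ scheme)).val
    · have h' : best.2 < profit win (A n loc s.val ⟨α, θ,
        (buildArray fun i => trim α θ scheme (win i)).val⟩).val := h
      rw [if_pos h, decide_eq_true h']
      rfl
    · have h' : ¬ best.2 < profit win (A n loc s.val ⟨α, θ,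
        (buildArray fun i => trim α θ scheme (win i)).val⟩).val := h
      rw [if_neg h, decide_eq_false h']
      rfl
  have hI : ∀ best θ, IsBest loc win s.val best → IsBest loc win s.val (body best θ).val := by
    intro best θ h
    rw [hval]
    split_ifs
    · exact ⟨(hA n loc s.val (trimmed win α θ scheme) hs hα).1, rfl⟩
    · exact h
  have hmono : ∀ best θ, best.2 ≤ (body best θ).val.2 := by
    intro best θ
    rw [hval]
    split_ifs with h
    · exact h.le
    · exact le_rfl
  refine ⟨forEach_preserves _ hb hI,
    forEach_preserves (fun b => best.2 ≤ b.2) le_rfl fun b θ h => h.trans (hmono b θ), ?_⟩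
  intro θ hθ
  refine forEach_establishes (fun _ => True)
    (fun b => profit win (A n loc s.val (trimmed win α θ scheme)).val ≤ b.2) hθ trivial
    (fun _ _ _ => trivial) ?_ fun b θ' _ h => h.trans (hmono b θ')
  intro b _
  rw [hval]
  split_ifs with h
  · exact le_rfl
  · exact not_lt.1 h

theorem speedup_steps {X : Type u} {A : TrimmedSolver X} {n : ℕ} (hn : 0 < n) (loc : Fin n → X)
    (win : Fin n → Window) (s : Speedup) (α θ₀ : ℝ) (scheme : Scheme) (best : Run n × ℕ) {D G : ℕ}
    (hD : ∀ c : ℕ, (c : ℕ∞) ≤ s.shifts → c ≤ numPeriodSets α win → c ≤ D) (hD0 : 0 < D)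
    (hG : ∀ T : Trimmed n, T.len = α → (A n loc s.val T).steps ≤ G) (hnG : n ≤ G) :
    (speedup A loc win s α θ₀ scheme best).steps ≤ 58 * (D * G) := by
  obtain ⟨h1, h2⟩ := startingPoints_bounds s α θ₀ win hD
  have h3 := forEach_steps_le' (l := (startingPoints s α θ₀ win).val) (s := best)
    (body := fun best θ => do
      let idx ← buildArray fun i => trim α θ scheme (win i)
      let R ← A n loc s.val ⟨α, θ, idx⟩
      let c ← countServed win R
      let better ← cost 1 (decide (best.2 < c))
      if better then cost 2 (R, c) else cost 1 best) (19 * n + G + 4) (by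
    intro best θ
    simp only [bind_steps, cost_val, cost_steps]
    have h4 : (buildArray fun i => trim α θ scheme (win i)).steps ≤ n * 14 := by
      change ∑ i : Fin n, ((trim α θ scheme (win i)).steps + 1) ≤ n * 14
      refine (Finset.sum_le_card_nsmul Finset.univ _ 14 fun i _ => ?_).trans (by simp)
      exact Nat.succ_le_succ (trim_steps α θ scheme (win i))
    have h5 := hG ⟨α, θ, (buildArray fun i => trim α θ scheme (win i)).val⟩ rfl
    have h6 := countServed_steps win
      (A n loc s.val ⟨α, θ, (buildArray fun i => trim α θ scheme (win i)).val⟩).val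
    generalize decide (best.2 < _) = b
    cases b <;> simp only [if_true, Bool.false_eq_true, if_false, cost_steps] <;> omega)
  have h7 : (speedup A loc win s α θ₀ scheme best).steps ≤
      (n * (4 * D + 17) + 5 * D + 6) + (D * (19 * n + G + 4 + 1) + 1) :=
    add_le_add h2 (h3.trans (by gcongr))
  refine h7.trans ?_
  have h8 : n * D ≤ D * G := by rw [mul_comm]; gcongr
  have h9 : D ≤ D * G := Nat.le_mul_of_pos_right _ (by omega)
  have h10 : n ≤ D * G := hnG.trans (Nat.le_mul_of_pos_left _ hD0)
  have e : (n * (4 * D + 17) + 5 * D + 6) + (D * (19 * n + G + 4 + 1) + 1) =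
      23 * (n * D) + 17 * n + 10 * D + D * G + 7 := by ring
  -- `58 = 23 + 17 + 10 + 1 + 7`, each term being absorbed into `D * G`.
  omega

/-! ### SPEEDUPW12 -/

/-- Only the passes with `α = 3/4`, `θ₀ = 0`, `j = 1` matter for the ratio; all other passes can
only improve the best run. -/
theorem speedupW12_spec {X : Type u} [MetricSpace X] {A : TrimmedSolver X} {γ : ℝ}
    (hA : A.HasRatio γ) {n : ℕ} (loc : Fin n → X) (win : Fin n → Window) {s : Speedup}
    (hs : 0 < s.val) :
    Feasible loc s.val (speedupW12 A loc win s).val ∧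
      ∀ θ ∈ (startingPoints s (3 / 4) 0 win).val,
        profit win (A n loc s.val (trimmed win (3 / 4) θ (scheme₂ 1))).val ≤
          profit win (speedupW12 A loc win s).val := by
  set I := IsBest loc win s.val with hI
  set J : Run n × ℕ → Prop := fun best => ∀ θ ∈ (startingPoints s (3 / 4) 0 win).val,
    profit win (A n loc s.val (trimmed win (3 / 4) θ (scheme₂ 1))).val ≤ best.2 with hJ
  have keep : ∀ {α : ℝ}, 0 < α → ∀ (θ₀ : ℝ) (scheme : Scheme) (b : Run n × ℕ), I b →
      I (speedup A loc win s α θ₀ scheme b).val :=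
    fun hα θ₀ scheme b hb => (speedup_spec hA loc win hs hα θ₀ scheme hb).1
  have keepJ : ∀ {α : ℝ}, 0 < α → ∀ (θ₀ : ℝ) (scheme : Scheme) (b : Run n × ℕ), I b ∧ J b →
      I (speedup A loc win s α θ₀ scheme b).val ∧ J (speedup A loc win s α θ₀ scheme b).val :=
    fun hα θ₀ scheme b hb => ⟨keep hα θ₀ scheme b hb.1, fun θ hθ =>
      (hb.2 θ hθ).trans (speedup_spec hA loc win hs hα θ₀ scheme hb.1).2.1⟩
  have h0 : I ((buildArray fun _ : Fin n => cost 1 (none : Option ℝ)).val, 0) := by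
    refine ⟨fun i j t u hi => by simp [buildArray, cost_val] at hi, ?_⟩
    simp [profit, served, buildArray, cost_val]
  have h12 : (0 : ℝ) < 1 / 2 := by norm_num
  have h34 : (0 : ℝ) < 3 / 4 := by norm_num
  simp only [speedupW12, bind_val, cost_val]
  set best₁ := (forEach [0, 1] ((buildArray fun _ : Fin n => cost 1 (none : Option ℝ)).val, 0)
    fun best (i : ℕ) => forEach [1, 2] best fun best (j : ℤ) =>
      forEach [1, 2, 3] best fun best (k : ℤ) =>
        speedup A loc win s (1 / 2) (i / 4) (scheme₁ j k) best).val with hb1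
  have h1 : I best₁ :=
    forEach_preserves I h0 fun b i hb => forEach_preserves I hb fun b j hb =>
      forEach_preserves I hb fun b k hb => keep h12 _ _ b hb
  have h2 := forEach_establishes (l := [0, 1, 2]) (s := best₁)
    (body := fun best (i : ℕ) => forEach [1, 2] best fun best (j : ℤ) =>
      speedup A loc win s (3 / 4) (i / 4) (scheme₂ j) best)
    I (fun b => I b ∧ J b) (b := 0) (by simp) h1
    (fun b i hb => forEach_preserves I hb fun b j hb => keep h34 _ _ b hb)
    (fun b hb => forEach_establishes I (fun b => I b ∧ J b) (b := 1) (by simp) hb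
      (fun b j hb => keep h34 _ _ b hb)
      (fun b hb => ⟨keep h34 _ _ b hb, by
        have := (speedup_spec hA loc win hs h34 ((0 : ℕ) / 4) (scheme₂ 1) hb).2.2
        rwa [Nat.cast_zero, zero_div] at this ⊢⟩)
      (fun b j _ hb => keepJ h34 _ _ b hb))
    (fun b i _ hb => forEach_preserves (fun b => I b ∧ J b) hb
      fun b j hb => keepJ h34 _ _ b hb)
  have h3 := forEach_preserves (l := [0, 1, 2, 3])
    (body := fun best (i : ℕ) => speedup A loc win s 1 (i / 4) scheme₃ best)
    (fun b => I b ∧ J b) h2 fun b i hb => keepJ one_pos _ _ b hb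
  exact ⟨h3.1.1, fun θ hθ => (h3.2 θ hθ).trans_eq h3.1.2⟩

theorem speedupW12_steps {X : Type u} {A : TrimmedSolver X} {n : ℕ} (hn : 0 < n) (loc : Fin n → X)
    (win : Fin n → Window) (s : Speedup) {D G : ℕ}
    (hD : ∀ α : ℝ, α = 1 / 2 ∨ α = 3 / 4 ∨ α = 1 →
      ∀ c : ℕ, (c : ℕ∞) ≤ s.shifts → c ≤ numPeriodSets α win → c ≤ D) (hD0 : 0 < D)
    (hG : ∀ T : Trimmed n, 0 < T.len → (A n loc s.val T).steps ≤ G) (hnG : n ≤ G) :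
    (speedupW12 A loc win s).steps ≤ 1322 * (D * G) := by
  have key : ∀ α : ℝ, α = 1 / 2 ∨ α = 3 / 4 ∨ α = 1 → ∀ θ₀ scheme best,
      (speedup A loc win s α θ₀ scheme best).steps ≤ 58 * (D * G) := by
    intro α hα θ₀ scheme best
    refine speedup_steps hn loc win s α θ₀ scheme best (hD α hα) hD0 (fun T hT => hG T ?_) hnG
    rw [hT]
    rcases hα with rfl | rfl | rfl <;> norm_num
  have h0 : (buildArray fun _ : Fin n => cost 1 (none : Option ℝ)).steps ≤ 2 * n := by
    simp [buildArray, cost_steps, mul_comm]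
  have h1 : ∀ best : Run n × ℕ, (forEach [0, 1] best fun best (i : ℕ) =>
      forEach [1, 2] best fun best (j : ℤ) => forEach [1, 2, 3] best fun best (k : ℤ) =>
        speedup A loc win s (1 / 2) (i / 4) (scheme₁ j k) best).steps ≤ _ :=
    fun best => forEach_steps_le' _ fun _ _ => forEach_steps_le' _ fun _ _ =>
      forEach_steps_le' _ fun _ _ => key _ (Or.inl rfl) _ _ _
  have h2 : ∀ best : Run n × ℕ, (forEach [0, 1, 2] best fun best (i : ℕ) =>
      forEach [1, 2] best fun best (j : ℤ) =>
        speedup A loc win s (3 / 4) (i / 4) (scheme₂ j) best).steps ≤ _ :=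
    fun best => forEach_steps_le' _ fun _ _ => forEach_steps_le' _ fun _ _ =>
      key _ (Or.inr (Or.inl rfl)) _ _ _
  have h3 : ∀ best : Run n × ℕ, (forEach [0, 1, 2, 3] best fun best (i : ℕ) =>
      speedup A loc win s 1 (i / 4) scheme₃ best).steps ≤ _ :=
    fun best => forEach_steps_le' _ fun _ _ => key _ (Or.inr (Or.inr rfl)) _ _ _
  refine (add_le_add h0 (add_le_add (h1 _) (add_le_add (h2 _)
    (add_le_add (h3 _) (le_refl 1))))).trans ?_
  have h4 : n ≤ D * G := hnG.trans (Nat.le_mul_of_pos_left _ hD0)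
  simp only [List.length_cons, List.length_nil]
  -- There are `12 + 6 + 4 = 22` calls, hence `22 * 58 = 1276`; loop control, the final step and the
  -- initial array add at most `46 * (D * G)`.
  omega

/-- The factor 3 covers both the doubling of `r` for the sake of parity and the passage from length
1/2 to length 3/4. -/
theorem shifts_le_minDen {n : ℕ} (win : Fin n → Window) (s : Speedup) {α : ℝ}
    (hα : α = 1 / 2 ∨ α = 3 / 4 ∨ α = 1) {c : ℕ} (hc : (c : ℕ∞) ≤ s.shifts)
    (hc' : c ≤ numPeriodSets α win) : c ≤ 3 * s.minDen (numPeriodSets (1 / 2) win) := by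
  have h : numPeriodSets α win ≤ 3 * numPeriodSets (1 / 2) win := by
    rcases hα with rfl | rfl | rfl
    · omega
    · exact numPeriodSets_le win (z := 2) (by norm_num) (by norm_num) (by norm_num)
    · exact (numPeriodSets_le win (β := 1 / 2) (d := 2) (z := 1) (by norm_num) (by norm_num)
        (by norm_num)).trans (Nat.mul_le_mul_right _ (by norm_num))
  cases s with
  | real s => exact hc'.trans h
  | ratio q r =>
    have h1 : c ≤ 2 * r := by
      rw [Speedup.shifts] at hc
      split_ifs at hc
      · exact (Nat.cast_le.1 hc).trans (by omega)
      · exact Nat.cast_le.1 hc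
    rw [Speedup.minDen]
    omega

theorem minDen_pos {s : Speedup} (hs : 0 < s.val) {m : ℕ} (hm : 0 < m) : 0 < s.minDen m := by
  cases s with
  | real s => exact hm
  | ratio q r =>
    refine lt_min (Nat.pos_of_ne_zero ?_) hm
    rintro rfl
    simp [Speedup.val] at hs

/-! ### The approximation ratio -/

theorem trimmed_profit_le {n : ℕ} (win : Fin n → Window) (θ : ℝ) (R : Run n) :
    (trimmed win (3 / 4) θ (scheme₂ 1)).profit R ≤ profit win R := by
  refine Set.ncard_le_ncard ?_ (Set.toFinite _)
  rintro i ⟨t, p, hR, hp, h1, h2⟩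
  have hα : (0 : ℝ) < 3 / 4 := by norm_num
  simp only [trimmed] at hp h1 h2
  rw [trim_val, Option.map_eq_some_iff] at hp
  obtain ⟨k, hk, rfl⟩ := hp
  have h3 : k = 1 ∧ 1 ≤ lastPeriod (3 / 4) θ (win i) - firstPeriod (3 / 4) θ (win i) := by
    simp only [scheme₂] at hk
    split_ifs at hk with h h'
    · exact ⟨(Option.some.inj hk).symm, by omega⟩
    · exact ⟨(Option.some.inj hk).symm, by omega⟩
  obtain ⟨rfl, h4⟩ := h3
  rw [add_sub_cancel_right] at h1 h2
  have h5 : ((firstPeriod (3 / 4) θ (win i) + 1 : ℤ) : ℝ) ≤ lastPeriod (3 / 4) θ (win i) := by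
    exact_mod_cast (by omega : firstPeriod (3 / 4) θ (win i) + 1 ≤ lastPeriod (3 / 4) θ (win i))
  push_cast at h5
  have h6 := (firstPeriod_spec hα θ (win i)).1
  have h7 := (lastPeriod_spec hα θ (win i)).1
  exact ⟨t, hR, by linarith, by linarith⟩

/-- Tested on a single request that can be serviced. It is needed only for `0 ≤ γ`. -/
theorem TrimmedSolver.HasRatio.one_le {X : Type u} [MetricSpace X] {A : TrimmedSolver X} {γ : ℝ}
    (hA : A.HasRatio γ) (x : X) : 1 ≤ γ := by
  have h := (hA 1 (fun _ => x) 1 ⟨1, 0, fun _ => some 0⟩ one_pos one_pos).2 (fun _ => some 0)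
    (fun i j t u _ _ => by simp)
  set T : Trimmed 1 := ⟨1, 0, fun _ => some 0⟩ with hT
  have h1 : T.profit (fun _ => some 0) = 1 := by
    have : {i : Fin 1 | ∃ t p, (some 0 : Option ℝ) = some t ∧ T.idx i = some p ∧
        T.start + p * T.len ≤ t ∧ t < T.start + (p + 1) * T.len} = Set.univ := by
      ext i
      simp [hT]
    rw [Trimmed.profit, this, Set.ncard_univ, Nat.card_eq_fintype_card, Fintype.card_fin]
  have h2 : ∀ R, T.profit R ≤ 1 := fun R => by
    refine (Set.ncard_le_ncard (Set.subset_univ _)).trans ?_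
    simp
  rw [h1] at h
  have h3 := h2 (A 1 (fun _ => x) 1 T).val
  generalize T.profit (A 1 (fun _ => x) 1 T).val = k at h h3
  interval_cases k
  · norm_num at h
  · simpa using h

/-- The compressed run is one competitor of the solver on the trimmed windows. It is built for
starting point `θ' + z * (3 / 4)`, which has the same divisions as `θ'` but numbers the first full
periods as `θ` does. -/
theorem card_le_of_samePeriods {X : Type u} [MetricSpace X] {A : TrimmedSolver X} {γ : ℝ}
    (hA : A.HasRatio γ) {n : ℕ} {loc : Fin n → X} {win : Fin n → Window} {R : Run n}
    (hR : Feasible loc 1 R) {s : ℝ} (hs : 1 < s) {θ θ' : ℝ} (hθ : SamePeriods (3 / 4) win θ θ')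
    (a : ℝ) (G : Finset (Fin n))
    (hW : ∀ i ∈ G, 3 / 2 < (win i).deadline - (win i).release ∧
      (win i).deadline - (win i).release ≤ 2)
    (hG : ∀ i ∈ G, ∃ t, R i = some t ∧ a + firstPeriod (3 / 4) θ (win i) * (3 / 4) ≤ t ∧
      t ≤ a + firstPeriod (3 / 4) θ (win i) * (3 / 4) + (s + 1) / 2 * (3 / 4)) :
    (G.card : ℝ) ≤ γ * (trimmed win (3 / 4) θ' (scheme₂ 1)).profit
      (A n loc s (trimmed win (3 / 4) θ' (scheme₂ 1))).val := by
  have hα : (0 : ℝ) < 3 / 4 := by norm_num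
  obtain ⟨z, hz⟩ := hθ
  obtain ⟨R', hR', hG'⟩ := exists_compressed_run hR hs hα a (θ' + z * (3 / 4))
    (fun i => firstPeriod (3 / 4) θ (win i)) G hG
  refine le_trans ?_ ((hA n loc s (trimmed win (3 / 4) θ' (scheme₂ 1)) (by linarith) hα).2 R' hR')
  rw [Nat.cast_le, ← Set.ncard_coe_finset]
  refine Set.ncard_le_ncard ?_ (Set.toFinite _)
  intro i hi
  obtain ⟨t, ht, h1, h2⟩ := hG' i hi
  refine ⟨t, firstPeriod (3 / 4) θ' (win i), ht, ?_, ?_, ?_⟩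
  · simp only [trimmed]
    rw [trim_val]
    rcases lastPeriod_sub_firstPeriod (hW i hi).1 (hW i hi).2 θ' with h | h <;>
      simp [h, scheme₂]
  · simp only [trimmed]
    rw [(hz i).1]
    push_cast
    linarith
  · simp only [trimmed]
    rw [(hz i).1]
    push_cast
    linarith

/-- The sets of periods that are tried represent all shifts by `3 / 4 / N`, where `N` is such that
`(s + 1) / 2 * N` is at least the least integer that is not less than `5 / 3 * N`. -/
theorem exists_grid {n : ℕ} (hn : 0 < n) (win : Fin n → Window) {s : Speedup}
    (hs : 7 / 3 ≤ s.val) :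
    ∃ (N : ℕ) (m : ℤ), 0 < N ∧ 5 * N ≤ 3 * m ∧ 3 * m ≤ 5 * N + 2 ∧ 2 * (m : ℝ) ≤ (s.val + 1) * N ∧
      ∀ k < N, ∃ θ' ∈ (startingPoints s (3 / 4) 0 win).val,
        SamePeriods (3 / 4) win (k * (3 / 4 / N)) θ' := by
  rcases startingPoints_val s (3 / 4) 0 win with h | ⟨N, hN, h⟩
  -- All shifts are available here, so `N` is free; `N = 3` makes `5 * N / 3` an integer.
  · refine ⟨3, 5, by norm_num, by norm_num, by norm_num, by push_cast; linarith, fun k _ => ?_⟩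
    exact exists_samePeriods hn (by norm_num) win h _
  · cases s with
    | real s => exact absurd hN (ENat.top_ne_natCast N)
    | ratio q r =>
      simp only [Speedup.val] at hs ⊢
      have hr : 0 < r := by
        refine Nat.pos_of_ne_zero ?_
        rintro rfl
        norm_num at hs
      have hr' : (0 : ℝ) < r := Nat.cast_pos.2 hr
      rw [le_div_iff₀ hr'] at hs
      have hqr : 7 * r ≤ 3 * q := by
        have : (7 * r : ℝ) ≤ 3 * q := by linarith
        exact_mod_cast this
      have hmem : ∀ k < N, ∃ θ' ∈ (startingPoints (.ratio q r) (3 / 4) 0 win).val,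
          SamePeriods (3 / 4) win (k * (3 / 4 / N)) θ' := by
        intro k hk
        refine ⟨_, ?_, samePeriods_refl _ _ _⟩
        rw [h]
        have := mem_gridPoints (3 / 4) 0 hk
        rwa [zero_add, mul_div_assoc] at this
      have hsum : ((q : ℝ) / r + 1) * r = q + r := by field_simp
      rw [Speedup.shifts] at hN
      split_ifs at hN with hev
      · obtain rfl : r = N := by exact_mod_cast hN
        refine ⟨r, (5 * r + 2) / 3, hr, by omega, by omega, ?_, hmem⟩
        rw [hsum]
        -- By parity `(q + r) / 2` is an integer; being at least `5 * r / 3`, it is at least the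
        -- rounded-up value `m`.
        obtain ⟨c, hc⟩ := hev
        have : 2 * (((5 * r + 2) / 3 : ℤ)) ≤ q + r := by omega
        exact_mod_cast this
      · obtain rfl : 2 * r = N := by exact_mod_cast hN
        -- With `N = 2 * r`, half of `(s + 1) * N` is the integer `q + r`.
        obtain ⟨m, h1, h2, h3⟩ : ∃ m : ℤ, 5 * (2 * r) ≤ 3 * m ∧ 3 * m ≤ 5 * (2 * r) + 2 ∧
            m ≤ q + r := ⟨(10 * r + 2) / 3, by omega, by omega, by omega⟩
        refine ⟨2 * r, m, by omega, by exact_mod_cast h1, by exact_mod_cast h2, ?_, hmem⟩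
        have h4 : (m : ℝ) ≤ q + r := by exact_mod_cast h3
        push_cast
        linarith

/-- Double counting of pairs of a request and a shift: for each shift and each kind of stretch at
most `V` requests are covered, while each request is covered with total weight at least `2 * N`. -/
theorem two_mul_profitOn_le {X : Type u} [MetricSpace X] {A : TrimmedSolver X} {γ : ℝ}
    (hA : A.HasRatio γ) {n : ℕ} (hn : 0 < n) {loc : Fin n → X} {win : Fin n → Window} {s : Speedup}
    (hwin : ∀ i, (win i).deadline - (win i).release ≤ 2) (hs : 7 / 3 ≤ s.val) (θ : ℝ) {R : Run n}
    (hR : Feasible loc 1 R) :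
    2 * (profitOn {i | InW 3 (1 / 2) θ (win i)} win R : ℝ) ≤
      5 * (γ * profit win (speedupW12 A loc win s).val) := by
  classical
  have hγ : 0 ≤ γ := zero_le_one.trans (hA.one_le (loc ⟨0, hn⟩))
  obtain ⟨N, m, hN, hm, hm', hms, hgrid⟩ := exists_grid hn win hs
  have hN' : (0 : ℝ) < N := Nat.cast_pos.2 hN
  set h : ℝ := 3 / 4 / N with hh
  have hpos : 0 < h := by positivity
  have hNh : N * h = 3 / 4 := by rw [hh]; field_simp
  have hmul : ∀ c : ℝ, c * (3 / 4) = c * N * h := fun c => by rw [mul_assoc, hNh]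
  -- `K` is the number of cells of length `h` needed for the maximal window length `2 = 8/3 * 3/4`.
  obtain ⟨K, hK, hK'⟩ : ∃ K : ℤ, 8 * N ≤ 3 * K ∧ 3 * K ≤ 8 * N + 2 :=
    ⟨(8 * N + 2) / 3, by omega, by omega⟩
  set S := (served win R ∩ {i | InW 3 (1 / 2) θ (win i)}).toFinset with hS
  have hcard : profitOn {i | InW 3 (1 / 2) θ (win i)} win R = S.card :=
    Set.ncard_eq_toFinset_card' _
  set V := γ * profit win (speedupW12 A loc win s).val with hV
  -- In units of `h`, `x i k` is the start of the first full period for starting point `k * h`, and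
  -- `Y i` is the cell of the service time. The default 0 never matters: requests in `S` are
  -- serviced.
  set x : Fin n → ℕ → ℤ := fun i k => k + firstPeriod (3 / 4) (k * h) (win i) * N with hx
  set Y : Fin n → ℤ := fun i => ⌊(R i).getD 0 / h⌋ with hYdef
  have upper : ∀ a : ℤ, ∀ k ∈ Finset.range N,
      ((S.filter fun i => a ≤ Y i - x i k ∧ Y i - x i k < a + m).card : ℝ) ≤ V := by
    intro a k hk
    obtain ⟨θ', hθ', hsame⟩ := hgrid k (Finset.mem_range.1 hk)
    have h1 := (speedupW12_spec hA loc win (s := s) (by linarith)).2 θ' hθ'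
    have h2 := trimmed_profit_le win θ' (A n loc s.val (trimmed win (3 / 4) θ' (scheme₂ 1))).val
    refine (card_le_of_samePeriods hA hR (s := s.val) (by linarith) hsame ((a + k) * h) _
      ?_ ?_).trans (mul_le_mul_of_nonneg_left (Nat.cast_le.2 (h2.trans h1)) hγ)
    · intro i hi
      have h3 := (Set.mem_toFinset.1 (Finset.mem_filter.1 hi).1).2
      exact ⟨length_of_inW_three h3, hwin i⟩
    · intro i hi
      obtain ⟨hi, h3, h4⟩ := Finset.mem_filter.1 hi
      obtain ⟨⟨t, ht, -⟩, -⟩ := Set.mem_toFinset.1 hi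
      refine ⟨t, ht, ?_, ?_⟩
      · have h5 : a + x i k ≤ ⌊t / h⌋ := by simp only [hYdef, ht, Option.getD_some] at h3; omega
        rw [Int.le_floor, le_div_iff₀ hpos] at h5
        simp only [hx] at h5
        push_cast at h5
        rw [hmul]
        linarith
      · have h5 : ⌊t / h⌋ < a + m + x i k := by
          simp only [hYdef, ht, Option.getD_some] at h4; omega
        rw [Int.floor_lt, div_lt_iff₀ hpos] at h5
        simp only [hx] at h5
        push_cast at h5
        have h6 := mul_le_mul_of_nonneg_right hms hpos.le
        rw [hmul, hmul]
        linarith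
  have lower : ∀ i ∈ S, 2 * N ≤
      2 * ((Finset.range N).filter fun k => -(N : ℤ) ≤ Y i - x i k ∧ Y i - x i k < -N + m).card +
      2 * ((Finset.range N).filter fun k => K - m ≤ Y i - x i k ∧ Y i - x i k < K - m + m).card +
      ((Finset.range N).filter fun k => 0 ≤ Y i - x i k ∧ Y i - x i k < 0 + m).card := by
    intro i hi
    obtain ⟨⟨t, ht, h1, h2⟩, -⟩ := Set.mem_toFinset.1 hi
    have hYt : Y i = ⌊t / h⌋ := by simp only [hYdef, ht, Option.getD_some]
    -- `e` is the first grid point after the release time; as `k` varies, the first full period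
    -- starts once at each of `e, …, e + N - 1`. The service may lie in the release cell `e - 1`.
    set e := ⌊(win i).release / h⌋ + 1 with he
    have hxe : ∀ k < N, e ≤ k + firstPeriod (3 / 4) (k * h) (win i) * N ∧
        k + firstPeriod (3 / 4) (k * h) (win i) * N < e + N := by
      intro k _
      obtain ⟨h3, h4⟩ := firstPeriod_spec (by norm_num : (0 : ℝ) < 3 / 4) (k * h) (win i)
      constructor
      · rw [he, Int.add_one_le_iff, Int.floor_lt, div_lt_iff₀ hpos]
        push_cast
        rw [hmul] at h3
        linarith
      · have : k + firstPeriod (3 / 4) (k * h) (win i) * N - N ≤ ⌊(win i).release / h⌋ := by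
          rw [Int.le_floor, le_div_iff₀ hpos]
          push_cast
          rw [hmul] at h4
          linarith
        omega
    have hY1 : e - 1 ≤ Y i := by
      rw [hYt, he, add_sub_cancel_right]
      exact Int.floor_le_floor (by gcongr)
    have hY2 : Y i - e < K := by
      have h3 : t / h < (win i).release / h + 8 / 3 * N := by
        have h4 : (win i).release / h + 8 / 3 * N = ((win i).release + 2) / h := by
          rw [add_div, add_right_inj, eq_div_iff hpos.ne', mul_assoc, hNh]
          norm_num
        rw [h4]
        have := hwin i
        exact div_lt_div_of_pos_right (by linarith) hpos
      have h4 := Int.floor_le (t / h)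
      have h5 := Int.lt_floor_add_one ((win i).release / h)
      have h6 : (3 * (Y i - e) : ℝ) < 8 * N := by
        rw [hYt, he]
        push_cast
        linarith
      have h7 : 3 * (Y i - e) < 8 * N := by exact_mod_cast h6
      omega
    have h8 := two_mul_le_card_covered hm hm' hK hK' hY1 hY2
    rwa [← card_filter_range_eq (fun k => firstPeriod (3 / 4) (k * h) (win i)) e hxe,
      ← card_filter_range_eq (fun k => firstPeriod (3 / 4) (k * h) (win i)) e hxe,
      ← card_filter_range_eq (fun k => firstPeriod (3 / 4) (k * h) (win i)) e hxe] at h8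
  have swap : ∀ a : ℤ,
      ∑ i ∈ S, ((Finset.range N).filter fun k => a ≤ Y i - x i k ∧ Y i - x i k < a + m).card =
        ∑ k ∈ Finset.range N, (S.filter fun i => a ≤ Y i - x i k ∧ Y i - x i k < a + m).card :=
    fun a => Finset.sum_card_bipartiteAbove_eq_sum_card_bipartiteBelow _
  have total : ∀ a : ℤ, ((∑ i ∈ S, ((Finset.range N).filter fun k =>
      a ≤ Y i - x i k ∧ Y i - x i k < a + m).card : ℕ) : ℝ) ≤ N * V := by
    intro a
    rw [swap, Nat.cast_sum]
    refine (Finset.sum_le_card_nsmul _ _ _ (upper a)).trans ?_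
    rw [Finset.card_range, nsmul_eq_mul]
  have h1 := Finset.sum_le_sum lower
  rw [Finset.sum_const, smul_eq_mul, Finset.sum_add_distrib, Finset.sum_add_distrib,
    ← Finset.mul_sum, ← Finset.mul_sum] at h1
  have h2 : (S.card * (2 * N) : ℝ) ≤ 2 * (N * V) + 2 * (N * V) + N * V := by
    refine le_trans (by exact_mod_cast h1) (add_le_add (add_le_add
      (mul_le_mul_of_nonneg_left (total _) zero_le_two)
      (mul_le_mul_of_nonneg_left (total _) zero_le_two)) (total 0))
  rw [hcard]
  refine le_of_mul_le_mul_left ?_ hN'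
  linarith

end Repairman

/-! ### Comparison of 5/2 with the stated ratio, and the absolute constant -/

theorem mainTheorem8 :
    ∃ C : ℕ, ∀ (X : Type*) [MetricSpace X] (A : Repairman.TrimmedSolver X) (γ : ℝ) (Γ : ℕ → ℝ),
      A.HasRatio γ → A.RunsIn Γ → (∀ n : ℕ, (n : ℝ) ≤ Γ n) →
      ∀ (n : ℕ) (loc : Fin n → X) (win : Fin n → Repairman.Window) (s : Repairman.Speedup) (θ : ℝ),
        (∀ i, 1 ≤ (win i).deadline - (win i).release ∧ (win i).deadline - (win i).release ≤ 2) →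
        7 / 3 ≤ s.val → s.val ≤ 17 / 7 →
        Repairman.Feasible loc s.val (Repairman.speedupW12 A loc win s).val ∧
        (∀ R : Repairman.Run n, Repairman.Feasible loc 1 R →
          (Repairman.profitOn {i | Repairman.InW 3 (1 / 2) θ (win i)} win R : ℝ) ≤
            8 * γ / (s.val ^ 2 - 4 * s.val + 7) *
              Repairman.profit win (Repairman.speedupW12 A loc win s).val) ∧
        (0 < n →
          ((Repairman.speedupW12 A loc win s).steps : ℝ) ≤
            C * s.minDen (Repairman.numPeriodSets (1 / 2) win) * Γ n) := by
  -- `3966 = 1322 * 3`, from `speedupW12_steps` with `D = 3 * m`.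
  refine ⟨3966, ?_⟩
  intro X _ A γ Γ hA hΓ hnΓ n loc win s θ hwin hs hs'
  have hs0 : 0 < s.val := by linarith
  refine ⟨(Repairman.speedupW12_spec hA loc win hs0).1, fun R hR => ?_, fun hn => ?_⟩
  -- Without requests `X` may be empty, and then `γ` may be negative; but both sides vanish.
  · rcases Nat.eq_zero_or_pos n with rfl | hn
    · simp [Repairman.profitOn, Repairman.profit, Set.eq_empty_of_isEmpty]
    · have h1 := Repairman.two_mul_profitOn_le hA hn (fun i => (hwin i).2) hs θ hR
      have h2 : 0 < s.val ^ 2 - 4 * s.val + 7 := by nlinarith [sq_nonneg (s.val - 2)]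
      -- By convexity the maximum is at an endpoint: 28/9 at 7/3 and 156/49 at 17/7, both below
      -- 16/5.
      have h3 : 5 * (s.val ^ 2 - 4 * s.val + 7) ≤ 16 := by
        nlinarith [mul_nonneg (sub_nonneg.2 hs) (sub_nonneg.2 hs')]
      set V := γ * (Repairman.profit win (Repairman.speedupW12 A loc win s).val : ℝ) with hV
      have h4 : (0 : ℝ) ≤ Repairman.profitOn {i | Repairman.InW 3 (1 / 2) θ (win i)} win R :=
        Nat.cast_nonneg _
      have h5 : 8 * γ / (s.val ^ 2 - 4 * s.val + 7) *
          (Repairman.profit win (Repairman.speedupW12 A loc win s).val : ℝ) =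
          8 * V / (s.val ^ 2 - 4 * s.val + 7) := by rw [hV]; ring
      rw [h5, le_div_iff₀ h2]
      nlinarith
  · set m := s.minDen (Repairman.numPeriodSets (1 / 2) win) with hm
    have hm0 : 0 < m := Repairman.minDen_pos hs0 (Repairman.numPeriodSets_pos hn _ _)
    have hΓ0 : 0 ≤ Γ n := (Nat.cast_nonneg n).trans (hnΓ n)
    have h1 := Repairman.speedupW12_steps (A := A) hn loc win s (D := 3 * m) (G := ⌊Γ n⌋₊)
      (fun α hα c hc hc' => Repairman.shifts_le_minDen win s hα hc hc') (by omega)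
      (fun T hT => Nat.le_floor (hΓ n loc s.val T hs0 hT)) (Nat.le_floor (hnΓ n))
    have h2 : ((Repairman.speedupW12 A loc win s).steps : ℝ) ≤ 1322 * (3 * m * ⌊Γ n⌋₊) := by
      exact_mod_cast h1
    have h3 : (m : ℝ) * ⌊Γ n⌋₊ ≤ m * Γ n :=
      mul_le_mul_of_nonneg_left (Nat.floor_le hΓ0) (Nat.cast_nonneg _)
    push_cast
    linarith
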